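/- Throughout, $\mathcal{C}$ is a quasitopos: a category with all finite limits and colimits that is locally cartesian closed and has a regular-subobject classifier. Composition is written $g\circ f$. **PBPO.** A PBPO rule $\rho$ consists of morphisms $L \xleftarrow{l} K \xrightarrow{r} R$, $L' \xleftarrow{l'} K' \xrightarrow{r'} R'$, $t_L : L\to L'$, $t_K : K\to K'$, $t_R : R\to R'$ with $t_L\circ l = l'\circ t_K$ and $t_R\circ r = r'\circ t_K$. It is canonical if the first square is a pullback and the second one is a pushout. There is a step $G_L \Rightarrow_{\mathrm{PBPO}}^{\rho} G_R$ if there are $m : L\to G_L$ and $\alpha : G_L\to L'$ with $t_L = \alpha\circ m$; a pullback $G_L \xleftarrow{g_L} G_K \xrightarrow{u'} K'$ of $\alpha$ and $l'$, with induced morphism $u : K\to G_K$ (so $g_L\circ u = m\circ l$ and $u'\circ u = t_K$); and a pushout $R \xrightarrow{w} G_R \xleftarrow{g_R} G_K$ of $r$ and $u$, with induced morphism $w' : G_R\to R'$ (so $w'\circ w = t_R$ and $w'\circ g_R = r'\circ u'$). **PBPO$^+$.** A PBPO$^+$ rule $\tau$ consists of morphisms $L \xleftarrow{l} K \xrightarrow{r}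 R$, $t_L : L\to L'$, $t_K : K\to K'$, $l' : K'\to L'$ such that $K$ with $l, t_K$ is a pullback of $t_L$ and $l'$. There is a step $G_L \Rightarrow_{\mathrm{PBPO}^+}^{\tau} G_R$ if there are $m : L\to G_L$ and $\alpha : G_L\to L'$ such that $L$ with $1_L$ and $m$ is a pullback of $t_L$ and $\alpha$; a pullback $G_L \xleftarrow{g_L} G_K \xrightarrow{u'} K'$ of $\alpha$ and $l'$, with the unique morphism $u : K\to G_K$ such that $u'\circ u = t_K$; and a pushout $R \xrightarrow{w} G_R \xleftarrow{g_R} G_K$ of $r$ and $u$. **Materialization.** An rm-materialization of $f : A\to B$ is a factorization $A \xrightarrow{f'} \langle f\rangle \xrightarrow{f''} B$ of $f$ with $f'$ a regular monomorphism such that for every factorization $f = \alpha\circ m$ with $m : A\to X$ a regular monomorphism there is a unique $\beta : X\to\langle f\rangle$ with $f''\circ\beta = \alpha$ for which $A$ with $1_A$ and $m$ is a pullback of $f'$ and $\beta$. **Compacted rules.** Let $\rho$ be a canonical PBPO rule and $t_L = f\circ e$ with $e : L\to L_e$ epic. A compacted rule $\rho_e$ is the PBPO$^+$ rule $$L_e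 \leftarrow K_e \rightarrow R_e,\qquad f' : L_e\to\langle f\rangle,\qquad K_e\to\langle f\rangle',\qquad \langle f\rangle'\to\langle f\rangle$$ read off from a commutative diagram with rows $L\leftarrow K\to R$, $L_e\leftarrow K_e\to R_e$, $\langle f\rangle\leftarrow\langle f\rangle'\to\langle f\rangle''$ and $L'\leftarrow K'\to R'$ and left column $L\xrightarrow{e} L_e\xrightarrow{f'}\langle f\rangle\xrightarrow{f''}L'$, where $f = f''\circ f'$ is an rm-materialization, the three squares on the left are pullbacks, the three squares on the right are pushouts, and the outer diagram is $\rho$. Let $\mathrm{compact}(\rho)$ be the class of all compacted rules $\rho_e$, for all factorizations $t_L = f\circ e$ with $e$ epic. **Theorem.** Let $\mathcal{C}$ be a quasitopos and $\rho$ a canonical PBPO rule in $\mathcal{C}$. Then for every factorization $t_L = f\circ e$ with $e$ epic a compacted rule $\rho_e$ exists, and the class $\mathrm{compact}(\rho)$ models $\rho$, that is, $$\Rightarrow_{\mathrm{PBPO}}^{\rho}\;=\;\bigcup_{\tau\in\mathrm{compact}(\rho)}\Rightarrow_{\mathrm{PBPO}^+}^{\tau}$$ as relations on the objects of $\mathcal{C}$.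 -/

import Mathlib

open CategoryTheory CategoryTheory.Limits

universe v u

namespace GraphRewriting

/-- A quasitopos: a category with all finite limits and colimits that is locally cartesian closed
(all pullback functors between slices have a right adjoint) and has a classifier for regular
subobjects. -/
class Quasitopos (C : Type u) [Category.{v} C] : Prop where
  [hasFiniteLimits : HasFiniteLimits C]
  [hasFiniteColimits : HasFiniteColimits C]
  locallyCartesianClosed : ∀ {X Y : C} (f : X ⟶ Y), (Over.pullback f).IsLeftAdjoint
  exists_regularSubobjectClassifier : ∃ (Ω : C) (truth : ⊤_ C ⟶ Ω),
    ∀ {U X : C} (m : U ⟶ X), IsRegularMono m →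
      ∃! χ : X ⟶ Ω, IsPullback m (terminal.from U) χ truth

attribute [instance] Quasitopos.hasFiniteLimits Quasitopos.hasFiniteColimits

variable {C : Type u} [Category.{v} C]

/-- `IsMaterialization M f f₁ f₂` says that `f = f₁ ≫ f₂` is an `M`-materialization of `f`: a
factorization with `f₁` in `M` such that, for every factorization `f = m ≫ α` with `m` in `M`,
there is a unique `β` with `β ≫ f₂ = α` for which the square of `m`, `𝟙`, `β` and `f₁` is a
pullback. -/
structure IsMaterialization (M : MorphismProperty C) {A B Y : C} (f : A ⟶ B)
    (f₁ : A ⟶ Y) (f₂ : Y ⟶ B) : Prop where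
  mem : M f₁
  fac : f₁ ≫ f₂ = f
  existsUnique : ∀ {X : C} (m : A ⟶ X) (α : X ⟶ B), M m → m ≫ α = f →
    ∃! β : X ⟶ Y, IsPullback m (𝟙 A) β f₁ ∧ β ≫ f₂ = α

/-- A PBPO rule: two commuting squares. The type objects are written `L'`, `K'`, `R'`.
```
  L  <--l--  K  --r-->  R
  |          |          |
  tL         tK         tR
  v          v          v
  L' <--l'-- K' --r'--> R'
```
-/
structure PBPORule (C : Type u) [Category.{v} C] where
  (L K R L' K' R' : C)
  l : K ⟶ L
  r : K ⟶ R
  l' : K' ⟶ L'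
  r' : K' ⟶ R'
  tL : L ⟶ L'
  tK : K ⟶ K'
  tR : R ⟶ R'
  comm_left : l ≫ tL = tK ≫ l'
  comm_right : r ≫ tR = tK ≫ r'

namespace PBPORule

/-- A PBPO rule is canonical if its left square is a pullback and its right square a pushout. -/
structure IsCanonical (ρ : PBPORule C) : Prop where
  isPullback : IsPullback ρ.l ρ.tK ρ.tL ρ.l'
  isPushout : IsPushout ρ.r ρ.tK ρ.tR ρ.r'

/-- A PBPO step with match `m` and adherence `α`. The morphism `u` is the one determined by the
pullback `G_K`, and `w'` the one determined by the pushout `G_R`. -/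
def StepWith (ρ : PBPORule C) (G_L G_R : C) (m : ρ.L ⟶ G_L) (α : G_L ⟶ ρ.L') : Prop :=
  m ≫ α = ρ.tL ∧
  ∃ (G_K : C) (gL : G_K ⟶ G_L) (u' : G_K ⟶ ρ.K') (u : ρ.K ⟶ G_K)
    (gR : G_K ⟶ G_R) (w : ρ.R ⟶ G_R) (w' : G_R ⟶ ρ.R'),
    IsPullback gL u' α ρ.l' ∧
    u ≫ gL = ρ.l ≫ m ∧ u ≫ u' = ρ.tK ∧
    IsPushout ρ.r u w gR ∧
    gR ≫ w' = u' ≫ ρ.r' ∧ w ≫ w' = ρ.tR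

/-- The PBPO step relation of `ρ`. -/
def Step (ρ : PBPORule C) (G_L G_R : C) : Prop :=
  ∃ (m : ρ.L ⟶ G_L) (α : G_L ⟶ ρ.L'), ρ.StepWith G_L G_R m α

end PBPORule

/-- A PBPO⁺ rule: a pullback square together with a morphism `r`.
```
  L  <--l--  K  --r-->  R
  |          |
  tL   PB    tK
  v          v
  L' <--l'-- K'
```
-/
structure PBPOPlusRule (C : Type u) [Category.{v} C] where
  (L K R L' K' : C)
  l : K ⟶ L
  r : K ⟶ R
  l' : K' ⟶ L'
  tL : L ⟶ L'
  tK : K ⟶ K'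
  isPullback : IsPullback l tK tL l'

namespace PBPOPlusRule

/-- A PBPO⁺ step with match `m` and adherence `α`, which have to form a strong match (the first
pullback). The morphism `u` is unique with `u ≫ u' = tK`. -/
def StepWith (τ : PBPOPlusRule C) (G_L G_R : C) (m : τ.L ⟶ G_L) (α : G_L ⟶ τ.L') : Prop :=
  IsPullback m (𝟙 τ.L) α τ.tL ∧
  ∃ (G_K : C) (gL : G_K ⟶ G_L) (u' : G_K ⟶ τ.K') (u : τ.K ⟶ G_K)
    (gR : G_K ⟶ G_R) (w : τ.R ⟶ G_R),
    IsPullback gL u' α τ.l' ∧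
    u ≫ u' = τ.tK ∧
    IsPushout τ.r u w gR

/-- The PBPO⁺ step relation of `τ`. -/
def Step (τ : PBPOPlusRule C) (G_L G_R : C) : Prop :=
  ∃ (m : τ.L ⟶ G_L) (α : G_L ⟶ τ.L'), τ.StepWith G_L G_R m α

end PBPOPlusRule

/-- The data of a compaction of a PBPO rule `ρ` along a factorization of `ρ.tL` into `e` and `f`:
```
  L  <----l---- K  ----r----> R
  |     PB      |     PO      |
  e             eK            eR
  v             v             v
  Le <---le---- Ke ---re----> Re
  |     PB      |     PO      |
  f₁            tKe           tRe
  v             v             v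
  M  <---lM---- MK ---rM----> MR
  |     PB      |     PO      |
  f₂            kM            qM
  v             v             v
  L' <---l'---- K' ---r'----> R'
```
Here `f = f₁ ≫ f₂` is a materialization with respect to the regular monomorphisms, and the columns
compose to `tL`, `tK` and `tR`. -/
structure Compaction (ρ : PBPORule C) {Le : C} (e : ρ.L ⟶ Le) (f : Le ⟶ ρ.L') where
  (M MK MR Ke Re : C)
  f₁ : Le ⟶ M
  f₂ : M ⟶ ρ.L'
  isMaterialization : IsMaterialization (MorphismProperty.regularMono C) f f₁ f₂
  lM : MK ⟶ M
  kM : MK ⟶ ρ.K'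
  isPullback_bot : IsPullback lM kM f₂ ρ.l'
  le : Ke ⟶ Le
  tKe : Ke ⟶ MK
  isPullback_mid : IsPullback le tKe f₁ lM
  eK : ρ.K ⟶ Ke
  isPullback_top : IsPullback ρ.l eK e le
  fac_K : eK ≫ tKe ≫ kM = ρ.tK
  re : Ke ⟶ Re
  eR : ρ.R ⟶ Re
  isPushout_top : IsPushout ρ.r eK eR re
  rM : MK ⟶ MR
  tRe : Re ⟶ MR
  isPushout_mid : IsPushout re tKe tRe rM
  qM : MR ⟶ ρ.R'
  isPushout_bot : IsPushout rM kM qM ρ.r'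
  fac_R : eR ≫ tRe ≫ qM = ρ.tR

/-- The compacted rule: the PBPO⁺ rule in the middle of the diagram of a compaction. -/
def Compaction.rule {ρ : PBPORule C} {Le : C} {e : ρ.L ⟶ Le} {f : Le ⟶ ρ.L'}
    (D : Compaction ρ e f) : PBPOPlusRule C where
  L := Le
  K := D.Ke
  R := D.Re
  L' := D.M
  K' := D.MK
  l := D.le
  r := D.re
  l' := D.lM
  tL := D.f₁
  tK := D.tKe
  isPullback := D.isPullback_mid

/-- The class of compacted rules of `ρ`, one (up to isomorphism) for each factorization of `ρ.tL`
as an epimorphism `e` followed by a morphism `f`. -/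
def compact (ρ : PBPORule C) : Set (PBPOPlusRule C) :=
  {τ | ∃ (Le : C) (e : ρ.L ⟶ Le) (f : Le ⟶ ρ.L'), Epi e ∧ e ≫ f = ρ.tL ∧
    ∃ D : Compaction ρ e f, τ = D.rule}

end GraphRewriting

/-! A quasitopos factors the match of a PBPO step as an epi `e` followed by a regular mono `m'`
(`exists_epi_regularMono_factorization`). Put `f = m' ≫ α`. The materialization of `f` lifts `α` to
an adherence that makes `m'` a strong match, and cancelling pullbacks and pushouts turns the step
into one of the rule compacted along `e` (`step_rule`). Conversely, pasting the outer squares of a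
compaction onto a PBPO⁺ step gives a PBPO step (`step_of_step_rule`). Materializations come from
classifying partial maps over the codomain, via a pushforward along a mono (`exists_pushforward`,
`exists_partialMapClassifier`). -/

namespace GraphRewriting

/-! ### Pushforward along a monomorphism. -/

section Pushforward

variable {C : Type u} [Category.{v} C]

/-- Composition with a monomorphism is fully faithful on slices. -/
def overMapFullyFaithful {B Z : C} (t : B ⟶ Z) [Mono t] : (Over.map t).FullyFaithful where
  preimage {X Y} g := Over.homMk g.left (by
    have h := Over.w g
    simpa [← cancel_mono t] using h)

/-- The pushforward of a morphism `f : A ⟶ B` along a monomorphism `t : B ⟶ Z`, with its universal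
property. -/
theorem exists_pushforward [HasPullbacks C] {A B Z : C} (t : B ⟶ Z) [Mono t]
    [(Over.pullback t).IsLeftAdjoint] (f : A ⟶ B) :
    ∃ (P : C) (p : P ⟶ Z) (i : A ⟶ P), IsPullback i f p t ∧
      ∀ {X D : C} (x : X ⟶ Z) (d : D ⟶ X) (b : D ⟶ B) (h : D ⟶ A), IsPullback d b x t →
        h ≫ f = b → ∃! β : X ⟶ P, β ≫ p = x ∧ d ≫ β = h ≫ i := by
  let adj := Adjunction.ofIsLeftAdjoint (Over.pullback t)
  let Q := (Over.pullback t).rightAdjoint.obj (Over.mk f)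
  let T : Adjunction.Triple _ _ _ := ⟨Over.mapPullbackAdj t, adj⟩
  -- In the adjoint triple of composition, pullback and pushforward along `t`, the outer functors
  -- are fully faithful together. So the counit `ε` is invertible: pulling the pushforward back
  -- along `t` recovers `f`.
  have hfull : (Over.pullback t).rightAdjoint.FullyFaithful :=
    T.fullyFaithfulEquiv (overMapFullyFaithful t)
  have := hfull.full
  have := hfull.faithful
  let ε : (Over.pullback t).obj Q ≅ Over.mk f := asIso (adj.counit.app (Over.mk f))
  let e : pullback Q.hom t ≅ A := (Over.forget _).mapIso ε
  have he : e.hom ≫ f = pullback.snd Q.hom t := Over.w ε.hom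
  have hinv : e.inv ≫ pullback.snd Q.hom t = f := by rw [← he, e.inv_hom_id_assoc]
  refine ⟨Q.left, Q.hom, e.inv ≫ pullback.fst Q.hom t, ?_, ?_⟩
  · exact (IsPullback.of_hasPullback Q.hom t).of_iso e (Iso.refl _) (Iso.refl _) (Iso.refl _)
      (by simp) (by simpa using he.symm) (by simp) (by simp)
  · intro X D x d b h hD hb
    let X' : Over Z := Over.mk x
    let j : pullback x t ≅ D := (hD.isoPullback).symm
    have hj₁ : j.hom ≫ d = pullback.fst x t := hD.isoPullback_inv_fst
    have hj₂ : j.hom ≫ b = pullback.snd x t := hD.isoPullback_inv_snd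
    let g : (Over.pullback t).obj X' ⟶ Over.mk f := Over.homMk (j.hom ≫ h) (by
      change (j.hom ≫ h) ≫ f = pullback.snd x t
      rw [Category.assoc, hb, hj₂])
    -- The adjunct of `k` is `g` exactly when `k` satisfies the equation of the universal property.
    have key : ∀ k : X' ⟶ Q, (Over.pullback t).map k ≫ ε.hom = g ↔
        d ≫ k.left = h ≫ e.inv ≫ pullback.fst Q.hom t := by
      intro k
      let q : pullback x t ⟶ pullback Q.hom t := ((Over.pullback t).map k).left
      have h₁ : q ≫ pullback.fst Q.hom t = pullback.fst x t ≫ k.left := pullback.lift_fst _ _ _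
      have h₂ : q ≫ pullback.snd Q.hom t = pullback.snd x t := pullback.lift_snd _ _ _
      constructor
      · intro hg
        have hl : q ≫ e.hom = j.hom ≫ h :=
          congrArg CommaMorphism.left hg
        rw [← cancel_epi j.hom, reassoc_of% hj₁, ← reassoc_of% hl, e.hom_inv_id_assoc, h₁]
      · intro hd
        ext
        change q ≫ e.hom = j.hom ≫ h
        rw [← cancel_mono e.inv, Category.assoc, e.hom_inv_id, Category.comp_id]
        apply pullback.hom_ext
        · rw [h₁, ← hj₁, Category.assoc, hd]
          simp
        · rw [h₂, Category.assoc, Category.assoc, hinv, hb, hj₂]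
    have hom : ∀ k : X' ⟶ Q, (adj.homEquiv X' (Over.mk f)).symm k =
        (Over.pullback t).map k ≫ ε.hom := fun k => adj.homEquiv_counit _ _ k
    refine ⟨(adj.homEquiv X' (Over.mk f) g).left, ⟨Over.w _, (key _).1 ?_⟩, ?_⟩
    · rw [← hom, Equiv.symm_apply_apply]
    · rintro β ⟨hβ, hβ'⟩
      let k : X' ⟶ Q := Over.homMk β hβ
      have hk := (key k).2 hβ'
      rw [← hom, Equiv.symm_apply_eq] at hk
      exact congrArg CommaMorphism.left hk

end Pushforward

variable {C : Type u} [Category.{v} C]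

theorem _root_.CategoryTheory.IsPullback.isRegularMono_fst {P X Y Z : C} {fst : P ⟶ X}
    {snd : P ⟶ Y} {f : X ⟶ Z} {g : Y ⟶ Z} (h : IsPullback fst snd f g) [IsRegularMono g] :
    IsRegularMono fst :=
  ⟨⟨regularOfIsPullbackFstOfRegular (IsRegularMono.getStruct g) h.w h.isLimit⟩⟩

/-! ### Partial maps, materializations and images in a quasitopos. -/

namespace Quasitopos

variable [Quasitopos C]

/-- Partial maps in the slice over `B`, with a regular monomorphism as domain inclusion, are
representable. -/
theorem exists_partialMapClassifier {A B : C} (f : A ⟶ B) :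
    ∃ (P : C) (f₁ : A ⟶ P) (f₂ : P ⟶ B), IsRegularMono f₁ ∧ f₁ ≫ f₂ = f ∧
      ∀ {X D : C} (d : D ⟶ X) (h : D ⟶ A) (α : X ⟶ B), IsRegularMono d → d ≫ α = h ≫ f →
        ∃! β : X ⟶ P, IsPullback d h β f₁ ∧ β ≫ f₂ = α := by
  obtain ⟨Ω, truth, hΩ⟩ := exists_regularSubobjectClassifier (C := C)
  -- A map `X ⟶ B ⨯ Ω` is a map `α` to `B` with a regular subobject of `X`; pulling `t` back along
  -- it gives that subobject with `α` restricted to it. Pushing `f` forward along `t` therefore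
  -- classifies lifts of the restriction through `f`.
  let t : B ⟶ B ⨯ Ω := prod.lift (𝟙 B) (terminal.from B ≫ truth)
  have ht : t ≫ prod.fst = 𝟙 B := prod.lift_fst _ _
  have ht' : t ≫ prod.snd = terminal.from B ≫ truth := prod.lift_snd _ _
  have : IsSplitMono t := ⟨⟨⟨prod.fst, ht⟩⟩⟩
  have : Mono truth := ⟨fun _ _ _ => Subsingleton.elim _ _⟩
  have htrue : IsPullback t (terminal.from B) prod.snd truth := by
    refine ⟨⟨ht'⟩, ⟨PullbackCone.IsLimit.mk _ (fun s => s.fst ≫ prod.fst) (fun s => ?_)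
      (fun s => Subsingleton.elim _ _) (fun s k hk _ => ?_)⟩⟩
    · apply Limits.prod.hom_ext
      · rw [Category.assoc, ht, Category.comp_id]
      · rw [Category.assoc, ht', s.condition, ← Category.assoc]
        congr 1
        exact Subsingleton.elim _ _
    · rw [← hk, Category.assoc, ht, Category.comp_id]
  have := locallyCartesianClosed t
  obtain ⟨P, p, f₁, hP, huniv⟩ := exists_pushforward t f
  have hf₁ : f₁ ≫ p ≫ prod.fst = f := by rw [reassoc_of% hP.w, ht, Category.comp_id]
  refine ⟨P, f₁, p ≫ prod.fst, hP.isRegularMono_fst, hf₁, ?_⟩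
  intro X D d h α hd hα
  obtain ⟨χ, hχ, hχu⟩ := hΩ d hd
  have hpb : IsPullback d (h ≫ f) (prod.lift α χ) t := by
    refine IsPullback.of_bot (v₂₁ := terminal.from B) (v₂₂ := prod.snd) ?_ ?_ htrue
    · rw [prod.lift_snd, Subsingleton.elim ((h ≫ f) ≫ terminal.from B) (terminal.from D)]
      exact hχ
    · apply Limits.prod.hom_ext
      · rw [Category.assoc, Category.assoc, prod.lift_fst, ht, Category.comp_id, hα]
      · rw [Category.assoc, Category.assoc, prod.lift_snd, ht', hχ.w, ← Category.assoc]
        congr 1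
        exact Subsingleton.elim _ _
  obtain ⟨β, ⟨hβ, hβ'⟩, hβu⟩ := huniv (prod.lift α χ) d (h ≫ f) h hpb rfl
  refine ⟨β, ⟨?_, ?_⟩, ?_⟩
  · exact IsPullback.of_bot (by rwa [hβ]) hβ' hP
  · rw [reassoc_of% hβ, prod.lift_fst]
  · rintro γ ⟨hγ, hγ'⟩
    refine hβu γ ⟨Limits.prod.hom_ext ?_ ?_, hγ.w⟩
    · rw [prod.lift_fst, Category.assoc, hγ']
    · rw [prod.lift_snd]
      -- The pullback square of `γ`, pasted with those of `t` and `truth`, shows that the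
      -- `Ω`-component classifies `d`.
      apply hχu
      have h₁ := (hγ.paste_vert hP).paste_vert htrue
      rwa [Subsingleton.elim ((h ≫ f) ≫ terminal.from B) (terminal.from D)] at h₁

/-- Every morphism has a materialization with respect to the regular monomorphisms. -/
theorem exists_isMaterialization {A B : C} (f : A ⟶ B) :
    ∃ (Y : C) (f₁ : A ⟶ Y) (f₂ : Y ⟶ B),
      IsMaterialization (MorphismProperty.regularMono C) f f₁ f₂ := by
  obtain ⟨Y, f₁, f₂, h₁, h₂, h₃⟩ := exists_partialMapClassifier f
  exact ⟨Y, f₁, f₂, h₁, h₂, fun m α hm hα => h₃ m (𝟙 A) α hm (by rw [hα, Category.id_comp])⟩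

/-- `m` is a pullback of `truth`; extending its classifying map along `n` to the partial map
classifier of `Ω` makes `m ≫ n` a pullback of `truth ≫ η`. That map starts at the terminal object,
so it is split mono. -/
theorem isRegularMono_comp {X Y Z : C} (m : X ⟶ Y) (n : Y ⟶ Z) (hm : IsRegularMono m)
    (hn : IsRegularMono n) : IsRegularMono (m ≫ n) := by
  obtain ⟨Ω, truth, hΩ⟩ := exists_regularSubobjectClassifier (C := C)
  obtain ⟨χ, hχ, -⟩ := hΩ m hm
  obtain ⟨P, η, _, -, -, hP⟩ := exists_partialMapClassifier (terminal.from Ω)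
  obtain ⟨β, ⟨hβ, -⟩, -⟩ := hP n χ (terminal.from Z) hn (Subsingleton.elim _ _)
  have : IsSplitMono (truth ≫ η) := ⟨⟨⟨terminal.from P, Subsingleton.elim _ _⟩⟩⟩
  exact (hχ.paste_horiz hβ).isRegularMono_fst

/-- Every morphism is an epimorphism followed by a regular monomorphism. -/
theorem exists_epi_regularMono_factorization {X Y : C} (m : X ⟶ Y) :
    ∃ (I : C) (e : X ⟶ I) (i : I ⟶ Y), Epi e ∧ IsRegularMono i ∧ e ≫ i = m := by
  let i := equalizer.ι (pushout.inl m m) (pushout.inr m m)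
  let e : X ⟶ equalizer (pushout.inl m m) (pushout.inr m m) :=
    equalizer.lift m pushout.condition
  have hei : e ≫ i = m := equalizer.lift_ι _ _
  refine ⟨_, e, i, ⟨fun a b hab => ?_⟩, inferInstance, hei⟩
  -- `m` factors through the regular mono `j ≫ i`. A pair with equalizer `j ≫ i` agrees on `m`,
  -- hence on `i`, so `i` factors through `j ≫ i`; then `j` is split epi and `a = b`.
  let j := equalizer.ι a b
  have hj : IsRegularMono (j ≫ i) := isRegularMono_comp j i inferInstance inferInstance
  obtain ⟨r⟩ := hj.regularMono
  have hm : equalizer.lift e hab ≫ j ≫ i = m := by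
    rw [equalizer.lift_ι_assoc, hei]
  have hr : m ≫ r.left = m ≫ r.right := by
    calc m ≫ r.left = (equalizer.lift e hab ≫ j ≫ i) ≫ r.left := congrArg (· ≫ r.left) hm.symm
      _ = (equalizer.lift e hab ≫ j ≫ i) ≫ r.right := by rw [Category.assoc, Category.assoc _ _ r.right, r.w]
      _ = m ≫ r.right := congrArg (· ≫ r.right) hm
  have hir : i ≫ r.left = i ≫ r.right := by
    have h := congrArg (· ≫ pushout.desc r.left r.right hr)
      (equalizer.condition (pushout.inl m m) (pushout.inr m m))
    simpa only [Category.assoc, pushout.inl_desc, pushout.inr_desc] using h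
  obtain ⟨s, hs⟩ := r.lift' i hir
  have hsj : s ≫ j = 𝟙 _ := by
    rw [← cancel_mono i, Category.assoc, hs, Category.id_comp]
  rw [← Category.id_comp a, ← Category.id_comp b, ← hsj, Category.assoc, Category.assoc,
    equalizer.condition]

end Quasitopos

/-! ### Existence of compactions. -/

/-- A materialization of `f` extends to a compaction of a canonical rule. -/
theorem nonempty_compaction_of_isMaterialization [HasPullbacks C] [HasPushouts C]
    {ρ : PBPORule C} (hρ : ρ.IsCanonical) {Le M : C} {e : ρ.L ⟶ Le} {f : Le ⟶ ρ.L'}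
    (hf : e ≫ f = ρ.tL) {f₁ : Le ⟶ M} {f₂ : M ⟶ ρ.L'}
    (h : IsMaterialization (MorphismProperty.regularMono C) f f₁ f₂) :
    Nonempty (Compaction ρ e f) := by
  have hbot := IsPullback.of_hasPullback f₂ ρ.l'
  have hmid := IsPullback.of_hasPullback f₁ (pullback.fst f₂ ρ.l')
  have hlow := hmid.flip.paste_horiz hbot.flip
  rw [h.fac] at hlow
  have hcomm : ρ.tK ≫ ρ.l' = (ρ.l ≫ e) ≫ f := by
    rw [Category.assoc, hf, ρ.comm_left]
  let eK := hlow.lift ρ.tK (ρ.l ≫ e) hcomm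
  have h₁ : eK ≫ pullback.snd f₁ (pullback.fst f₂ ρ.l') ≫ pullback.snd f₂ ρ.l' = ρ.tK :=
    hlow.lift_fst _ _ _
  have h₂ : eK ≫ pullback.fst f₁ (pullback.fst f₂ ρ.l') = ρ.l ≫ e := hlow.lift_snd _ _ _
  have hpb := hρ.isPullback
  rw [← hf, ← h₁] at hpb
  -- The left column is built upwards by pullbacks, the right one downwards by pushouts. Canonicity
  -- makes the outer squares a pullback and a pushout, so cancellation gives the remaining square on
  -- each side.
  have htop := IsPullback.of_bot hpb h₂.symm hlow.flip
  have potop := IsPushout.of_hasPushout ρ.r eK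
  have pomid := IsPushout.of_hasPushout (pushout.inr ρ.r eK)
    (pullback.snd f₁ (pullback.fst f₂ ρ.l'))
  have pohigh := potop.paste_vert pomid
  have hcomm' : ρ.r ≫ ρ.tR = (eK ≫ pullback.snd f₁ (pullback.fst f₂ ρ.l')) ≫
      pullback.snd f₂ ρ.l' ≫ ρ.r' := by
    rw [ρ.comm_right, ← h₁]
    simp only [Category.assoc]
  have hpo := hρ.isPushout
  rw [← h₁, ← Category.assoc] at hpo
  rw [← pohigh.inl_desc _ _ hcomm'] at hpo
  exact ⟨{
    M := M
    MK := _
    MR := _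
    Ke := _
    Re := _
    f₁ := f₁
    f₂ := f₂
    isMaterialization := h
    lM := _
    kM := _
    isPullback_bot := hbot
    le := _
    tKe := _
    isPullback_mid := hmid
    eK := eK
    isPullback_top := htop
    fac_K := h₁
    re := _
    eR := _
    isPushout_top := potop
    rM := _
    tRe := _
    isPushout_mid := pomid
    qM := pohigh.desc _ _ hcomm'
    isPushout_bot := IsPushout.of_top hpo (pohigh.inr_desc _ _ hcomm') pohigh
    fac_R := by
      rw [← Category.assoc]
      exact pohigh.inl_desc _ _ hcomm' }⟩

theorem nonempty_compaction [Quasitopos C] {ρ : PBPORule C} (hρ : ρ.IsCanonical) {Le : C}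
    (e : ρ.L ⟶ Le) (f : Le ⟶ ρ.L') (hf : e ≫ f = ρ.tL) : Nonempty (Compaction ρ e f) := by
  obtain ⟨M, f₁, f₂, h⟩ := Quasitopos.exists_isMaterialization f
  exact nonempty_compaction_of_isMaterialization hρ hf h

/-! ### Transfer of steps between a rule and its compactions. -/

namespace Compaction

variable {ρ : PBPORule C} {Le : C} {e : ρ.L ⟶ Le} {f : Le ⟶ ρ.L'}

/-- A PBPO step whose match factors as `e` followed by a regular monomorphism is a step of the
compacted rule. -/
theorem step_rule (D : Compaction ρ e f) {G_L G_R : C} (m : Le ⟶ G_L) (hm : IsRegularMono m)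
    (α : G_L ⟶ ρ.L') (hα : m ≫ α = f) (h : ρ.StepWith G_L G_R (e ≫ m) α) :
    D.rule.Step G_L G_R := by
  obtain ⟨-, G_K, gL, u', u, gR, w, -, hG, hu, hu', hpo, -, -⟩ := h
  obtain ⟨β, ⟨hβ, hβα⟩, -⟩ := D.isMaterialization.existsUnique m α hm hα
  have hcomm : (gL ≫ β) ≫ D.f₂ = u' ≫ ρ.l' := by rw [Category.assoc, hβα, hG.w]
  let v : G_K ⟶ D.MK := D.isPullback_bot.lift (gL ≫ β) u' hcomm
  have hv₁ : v ≫ D.lM = gL ≫ β := D.isPullback_bot.lift_fst _ _ hcomm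
  have hv₂ : v ≫ D.kM = u' := D.isPullback_bot.lift_snd _ _ hcomm
  -- The same `G_K` serves both steps: its pullback over `ρ.l'` factors through the bottom square of
  -- the compaction.
  have hGv : IsPullback gL v β D.lM :=
    IsPullback.of_bot (by rwa [hv₂, hβα]) hv₁.symm D.isPullback_bot
  have hcomm' : (D.le ≫ m) ≫ β = D.tKe ≫ D.lM := by
    rw [Category.assoc, hβ.w, Category.id_comp, D.isPullback_mid.w]
  let ue : D.Ke ⟶ G_K := hGv.lift (D.le ≫ m) D.tKe hcomm'
  have hue₁ : ue ≫ gL = D.le ≫ m := hGv.lift_fst _ _ hcomm'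
  have hue₂ : ue ≫ v = D.tKe := hGv.lift_snd _ _ hcomm'
  have huu : D.eK ≫ ue = u := by
    apply hG.hom_ext
    · rw [Category.assoc, hue₁, hu, reassoc_of% D.isPullback_top.w]
    · rw [Category.assoc, ← hv₂, reassoc_of% hue₂, D.fac_K, ← hu', hv₂]
  rw [← huu] at hpo
  have hw : ρ.r ≫ w = D.eK ≫ ue ≫ gR := by rw [hpo.w, Category.assoc]
  let we : D.Re ⟶ G_R := D.isPushout_top.desc w (ue ≫ gR) hw
  have hwe₁ : D.eR ≫ we = w := D.isPushout_top.inl_desc _ _ hw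
  have hwe₂ : D.re ≫ we = ue ≫ gR := D.isPushout_top.inr_desc _ _ hw
  rw [← hwe₁] at hpo
  exact ⟨m, β, hβ, G_K, gL, v, ue, gR, we, hGv, hue₂,
    IsPushout.of_top hpo hwe₂ D.isPushout_top⟩

/-- A step of a compacted rule is a PBPO step. -/
theorem step_of_step_rule (D : Compaction ρ e f) (hf : e ≫ f = ρ.tL) {G_L G_R : C}
    (h : D.rule.Step G_L G_R) : ρ.Step G_L G_R := by
  obtain ⟨m, β, hβ, G_K, gL, v, ue, gR, we, hGv, hue, hpo⟩ := h
  change Le ⟶ G_L at m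
  change G_L ⟶ D.M at β
  change G_K ⟶ D.MK at v
  change D.Ke ⟶ G_K at ue
  change D.Re ⟶ G_R at we
  change IsPullback m (𝟙 Le) β D.f₁ at hβ
  change IsPullback gL v β D.lM at hGv
  change ue ≫ v = D.tKe at hue
  change IsPushout D.re ue we gR at hpo
  -- A PBPO⁺ step only prescribes `ue ≫ v`. The strong match forces the other leg: a map into `G_L`
  -- that `β` sends into `D.f₁` factors through `m` in only one way.
  have hle : ue ≫ gL = D.le ≫ m := by
    have hcomm : (ue ≫ gL) ≫ β = D.le ≫ D.f₁ := by
      rw [Category.assoc, hGv.w, reassoc_of% hue, D.isPullback_mid.w]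
    have h₁ := hβ.lift_fst _ _ hcomm
    have h₂ := hβ.lift_snd _ _ hcomm
    rw [Category.comp_id] at h₂
    rw [← h₁, h₂]
  have hpo' := D.isPushout_top.paste_vert hpo
  have hK : (D.eK ≫ ue) ≫ v ≫ D.kM = ρ.tK := by
    rw [Category.assoc, reassoc_of% hue, D.fac_K]
  have hcomm : ρ.r ≫ ρ.tR = (D.eK ≫ ue) ≫ (v ≫ D.kM) ≫ ρ.r' := by
    rw [ρ.comm_right, ← hK]
    simp only [Category.assoc]
  refine ⟨e ≫ m, β ≫ D.f₂, ?_, G_K, gL, v ≫ D.kM, D.eK ≫ ue, gR, D.eR ≫ we,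
    hpo'.desc _ _ hcomm, hGv.paste_vert D.isPullback_bot, ?_, hK, hpo',
    hpo'.inr_desc _ _ hcomm, hpo'.inl_desc _ _ hcomm⟩
  · rw [Category.assoc, reassoc_of% hβ.w, D.isMaterialization.fac, hf]
  · rw [Category.assoc, hle, reassoc_of% D.isPullback_top.w]

end Compaction

end GraphRewriting

theorem mainTheorem3 {C : Type u} [Category.{v} C] [GraphRewriting.Quasitopos C]
    (ρ : GraphRewriting.PBPORule C) (hρ : ρ.IsCanonical) :
    (∀ {Le : C} (e : ρ.L ⟶ Le) (f : Le ⟶ ρ.L'), Epi e → e ≫ f = ρ.tL →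
      Nonempty (GraphRewriting.Compaction ρ e f)) ∧
    ∀ G_L G_R : C, ρ.Step G_L G_R ↔ ∃ τ ∈ GraphRewriting.compact ρ, τ.Step G_L G_R := by
  refine ⟨fun e f _ hf => GraphRewriting.nonempty_compaction hρ e f hf, fun G_L G_R => ⟨?_, ?_⟩⟩
  · rintro ⟨m, α, h⟩
    obtain ⟨Le, e, m', he, hm', rfl⟩ :=
      GraphRewriting.Quasitopos.exists_epi_regularMono_factorization m
    have hf : e ≫ m' ≫ α = ρ.tL := by rw [← Category.assoc, h.1]
    obtain ⟨D⟩ := GraphRewriting.nonempty_compaction hρ e (m' ≫ α) hf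
    exact ⟨D.rule, ⟨Le, e, m' ≫ α, he, hf, D, rfl⟩, D.step_rule m' hm' α rfl h⟩
  · rintro ⟨τ, ⟨Le, e, f, -, hf, D, rfl⟩, h⟩
    exact D.step_of_step_rule hf h
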